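/- Let $\mathsf H$ be a right quaternionic Hilbert space, i.e. a right vector space over the quaternions $\mathbb H$ with an $\mathbb H$-valued inner product satisfying $\overline{\langle u,v\rangle}=\langle v,u\rangle$, $\langle u,u\rangle>0$ for $u\neq 0$, and $\langle u,vp+wq\rangle=\langle u,v\rangle p+\langle u,w\rangle q$, complete for the norm $\|u\|=\sqrt{\langle u,u\rangle}$. Let $\mathfrak B(\mathsf H)$ be the algebra of bounded right linear operators on $\mathsf H$. For $S,T\in\mathfrak B(\mathsf H)$ write $S\le T$ if $\langle (T-S)u,u\rangle$ is real and nonnegative for every $u\in\mathsf H$. Powers $A^p$ ($p>0$) of a positive operator $A$ are taken in the continuous functional calculus of selfadjoint operators, $f\mapsto f(A)$ for real continuous functions $f$ on the spherical spectrum $$\sigma_S(A)=\{q\in\mathbb H:\ A^2-2\,\mathrm{Re}(q)\,A+|q|^2I \text{ is not invertible in } \mathfrak B(\mathsf H)\}\subset[0,\infty),$$ and $|T|=(T^*T)^{1/2}$. For $0<p\le 1$, an operator $T\in\mathfrak B(\mathsf H)$ is called $p$-hyponormal if $(T^*T)^p\ge (TT^*)^p$. Theorem. Let $0<p<\tfrac12$,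 let $T\in\mathfrak B(\mathsf H)$ be $p$-hyponormal, and let $T=U|T|$ be its polar decomposition, where $U\in\mathfrak B(\mathsf H)$ satisfies $\|Uu\|=\|u\|$ for $u\in(\ker|T|)^\perp$ and $Uu=0$ for $u\in\ker|T|$. Then its Aluthge transform $$\widetilde T=|T|^{1/2}\,U\,|T|^{1/2}$$ is $(p+\tfrac12)$-hyponormal, i.e. $(\widetilde T^*\widetilde T)^{p+1/2}\ge(\widetilde T\widetilde T^*)^{p+1/2}$. -/

import Mathlib

open scoped Quaternion

noncomputable section

/-- A right quaternionic inner product space: a right vector space over the quaternions (a module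
over the opposite ring; `MulOpposite.op q • u` is the right multiple `u q`) with an inner product
`inner ℍ u v`, right linear in the second variable, whose norm is `‖u‖ = √⟨u, u⟩`.
It is a right quaternionic Hilbert space when it is moreover complete.
Positive definiteness is contained in `qinner_self_eq`. -/
class RightQuaternionicInnerProductSpace (H : Type*) [NormedAddCommGroup H] [Module ℍᵐᵒᵖ H]
    extends Inner ℍ H where
  star_inner : ∀ u v : H, star (inner u v) = inner v u
  qinner_add_right : ∀ u v w : H, inner u (v + w) = inner u v + inner u w
  qinner_smul_right : ∀ (u v : H) (q : ℍ), inner u (MulOpposite.op q • v) = inner u v * q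
  qinner_self_eq : ∀ u : H, inner u u = ((‖u‖ ^ 2 : ℝ) : ℍ)

namespace RightQuaternionicInnerProductSpace

section Space

variable {H : Type*} [NormedAddCommGroup H] [Module ℍᵐᵒᵖ H] [RightQuaternionicInnerProductSpace H]

theorem qinner_add_left (u v w : H) : inner ℍ (u + v) w = inner ℍ u w + inner ℍ v w := by
  rw [← star_inner w, qinner_add_right, star_add, star_inner, star_inner]

theorem qinner_smul_left (u v : H) (q : ℍ) :
    inner ℍ (MulOpposite.op q • u) v = star q * inner ℍ u v := by
  rw [← star_inner v, qinner_smul_right, star_mul, star_inner]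

/-- Real scalars act through the quaternions. -/
instance realModule : Module ℝ H := Module.compHom H (algebraMap ℝ ℍᵐᵒᵖ)

theorem real_smul_def (r : ℝ) (u : H) : r • u = MulOpposite.op (r : ℍ) • u := rfl

instance : IsScalarTower ℝ ℍᵐᵒᵖ H where
  smul_assoc r q u := by
    rw [Algebra.smul_def, mul_smul]
    rfl

instance : SMulCommClass ℍᵐᵒᵖ ℝ H where
  smul_comm q r u := by
    rw [real_smul_def, real_smul_def, ← mul_smul, ← mul_smul]
    congr 1
    apply MulOpposite.unop_injective
    exact Quaternion.coe_commutes r q.unop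

/-- The underlying real inner product space, with inner product `Re ⟨u, v⟩` and the same norm. -/
instance realInnerProductSpace : InnerProductSpace ℝ H where
  norm_smul_le r u := by
    have h : ‖r • u‖ ^ 2 = (‖r‖ * ‖u‖) ^ 2 := by
      have h1 := qinner_self_eq (r • u)
      rw [real_smul_def, qinner_smul_right, qinner_smul_left, qinner_self_eq] at h1
      have h2 := congrArg (fun q : ℍ => q.re) h1
      simp only [Quaternion.star_coe, ← Quaternion.coe_mul, Quaternion.re_coe] at h2
      rw [real_smul_def, ← h2, mul_pow, Real.norm_eq_abs, sq_abs]
      ring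
    exact (abs_le_of_sq_le_sq' h.le (by positivity)).2
  inner u v := (inner ℍ u v).re
  norm_sq_eq_re_inner u := by
    change ‖u‖ ^ 2 = (inner ℍ u u).re
    rw [qinner_self_eq, Quaternion.re_coe]
  conj_inner_symm u v := by
    change (inner ℍ v u).re = (inner ℍ u v).re
    rw [← star_inner u v, Quaternion.re_star]
  add_left u v w := by
    change (inner ℍ (u + v) w).re = (inner ℍ u w).re + (inner ℍ v w).re
    rw [qinner_add_left, Quaternion.re_add]
  smul_left u v r := by
    change (inner ℍ (r • u) v).re = r * (inner ℍ u v).re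
    rw [real_smul_def, qinner_smul_left]
    simp

theorem real_inner_def (u v : H) : inner ℝ u v = (inner ℍ u v).re := rfl

/-- An element is determined by its inner products. -/
theorem ext_inner {u v : H} (h : ∀ w, inner ℍ u w = inner ℍ v w) : u = v :=
  ext_inner_right ℝ fun w => by rw [real_inner_def, real_inner_def, h]

/-- The quaternionic inner product is determined by its real part. -/
theorem inner_eq_of_re {u v u' v' : H}
    (h : ∀ q : ℍ, (inner ℍ u (MulOpposite.op q • v)).re = (inner ℍ u' (MulOpposite.op q • v')).re) :
    inner ℍ u v = inner ℍ u' v' := by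
  simp only [qinner_smul_right] at h
  have h1 := h (star (inner ℍ u v - inner ℍ u' v'))
  rw [← sub_eq_zero, ← Quaternion.re_sub, ← sub_mul, ← Quaternion.inner_def] at h1
  exact sub_eq_zero.mp (inner_self_eq_zero.mp h1)

end Space

end RightQuaternionicInnerProductSpace

/-- `𝔅(H)`: the bounded right linear operators on `H`. -/
abbrev QuaternionicOperator (H : Type*) [NormedAddCommGroup H] [Module ℍᵐᵒᵖ H] : Type _ :=
  H →L[ℍᵐᵒᵖ] H

namespace QuaternionicOperator

open RightQuaternionicInnerProductSpace

section Adjoint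

variable {H : Type*} [NormedAddCommGroup H] [Module ℍᵐᵒᵖ H] [RightQuaternionicInnerProductSpace H]

/-- `𝔅(H)` is a real unital algebra. -/
instance : Algebra ℝ (QuaternionicOperator H) :=
  Algebra.ofModule (fun _ _ _ => rfl) (fun r S T => by
    ext u
    exact (S.restrictScalars ℝ).map_smul r (T u))

variable [CompleteSpace H]

/-- The adjoint `T*`, characterised by `inner_adjoint_left` below. The underlying real-linear map is
the adjoint for the real inner product `Re ⟨u, v⟩`. -/
def adjoint (T : QuaternionicOperator H) : QuaternionicOperator H where
  toFun := ContinuousLinearMap.adjoint (T.restrictScalars ℝ)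
  map_add' := map_add _
  map_smul' q u := by
    refine ext_inner_right ℝ fun w => ?_
    obtain ⟨q, rfl⟩ := MulOpposite.op_surjective q
    have key : ∀ a b : H, (inner ℍ (MulOpposite.op q • a) b).re
        = (inner ℍ a (MulOpposite.op (star q) • b)).re := fun a b => by
      rw [qinner_smul_left, qinner_smul_right, Quaternion.re_mul, Quaternion.re_mul]
      ring
    rw [ContinuousLinearMap.adjoint_inner_left, real_inner_def, key, RingHom.id_apply,
      real_inner_def, key, ← real_inner_def, ← real_inner_def,
      ContinuousLinearMap.adjoint_inner_left]
    simp
  cont := (ContinuousLinearMap.adjoint (T.restrictScalars ℝ)).continuous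

theorem inner_adjoint_left (T : QuaternionicOperator H) (u v : H) :
    inner ℍ (adjoint T u) v = inner ℍ u (T v) := by
  refine inner_eq_of_re fun q => ?_
  rw [← T.map_smul, ← real_inner_def, ← real_inner_def]
  exact ContinuousLinearMap.adjoint_inner_left (T.restrictScalars ℝ) _ _

theorem inner_adjoint_right (T : QuaternionicOperator H) (u v : H) :
    inner ℍ u (adjoint T v) = inner ℍ (T u) v := by
  rw [← star_inner, inner_adjoint_left, star_inner]

/-- `star T` is the adjoint `T*`. -/
instance : StarRing (QuaternionicOperator H) where
  star := adjoint
  star_involutive T := by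
    ext u
    refine ext_inner fun w => ?_
    rw [inner_adjoint_left, inner_adjoint_right]
  star_mul S T := by
    ext u
    refine ext_inner fun w => ?_
    simp only [inner_adjoint_left, mul_apply_eq_comp]
  star_add S T := by
    ext u
    refine ext_inner fun w => ?_
    simp only [inner_adjoint_left, add_apply, qinner_add_left, qinner_add_right]

theorem star_eq_adjoint (T : QuaternionicOperator H) : star T = adjoint T := rfl

end Adjoint

section FunctionalCalculus

variable {H : Type*} [NormedAddCommGroup H] [Module ℍᵐᵒᵖ H] [RightQuaternionicInnerProductSpace H]

/-- `T` is positive: `⟨T u, u⟩` is a nonnegative real number for every `u`. -/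
def IsPositive (T : QuaternionicOperator H) : Prop :=
  ∀ u : H, ∃ r : ℝ, 0 ≤ r ∧ inner ℍ (T u) u = (r : ℍ)

/-- The operator inequality `S ≤ T`. -/
def OpLE (S T : QuaternionicOperator H) : Prop := IsPositive (T - S)

/-- `Δ_q(T) = T² - T (q + q̄) + |q|² I`; note that `q + q̄ = 2 Re q` is real. -/
def sphericalDelta (T : QuaternionicOperator H) (q : ℍ) : QuaternionicOperator H :=
  T ^ 2 - (2 * q.re) • T + (‖q‖ ^ 2) • (1 : QuaternionicOperator H)

/-- The spherical spectrum `σ_S(T)`: those `q` for which `Δ_q(T)` has no inverse in `𝔅(H)`. -/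
def sphericalSpectrum (T : QuaternionicOperator H) : Set ℍ :=
  {q | ¬ IsUnit (sphericalDelta T q)}

/-- The inclusion `σ_S(T) → ℝ` of the spherical spectrum of a selfadjoint operator, which consists
of real quaternions, as a real function. -/
def spectrumId (T : QuaternionicOperator H) : C(sphericalSpectrum T, ℝ) :=
  ⟨fun q => (q : ℍ).re, Quaternion.continuous_re.comp continuous_subtype_val⟩

variable [CompleteSpace H]

/-- `Φ` is the continuous functional calculus of the selfadjoint operator `T`: a homomorphism of
real unital algebras, continuous for the supremum norm and the operator norm, with selfadjoint
values (as a homomorphism of star algebras), positive, and sending the identity function to `T`. -/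
structure IsFunctionalCalculus (T : QuaternionicOperator H)
    (Φ : C(sphericalSpectrum T, ℝ) →⋆ₐ[ℝ] QuaternionicOperator H) : Prop where
  continuous : Continuous fun f => ((Φ f).restrictScalars ℝ : H →L[ℝ] H)
  map_id : Φ (spectrumId T) = T
  positive : ∀ f, (∀ q, 0 ≤ f q) → IsPositive (Φ f)

open scoped Classical in
/-- The operator `f(T)`, for `T` selfadjoint and `f` a real function continuous on `σ_S(T) ⊆ ℝ`. -/
def funCalc (f : ℝ → ℝ) (T : QuaternionicOperator H) : QuaternionicOperator H :=
  if h : (∃ Φ, IsFunctionalCalculus T Φ) ∧ Continuous (fun q : sphericalSpectrum T => f (q : ℍ).re)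
  then h.1.choose ⟨_, h.2⟩ else 0

/-- The power `T ^ p` of a positive operator, for `p > 0`. -/
def rpow (T : QuaternionicOperator H) (p : ℝ) : QuaternionicOperator H :=
  funCalc (fun t => t ^ p) T

/-- The modulus `|T| = (T* T) ^ (1/2)`. -/
def modulus (T : QuaternionicOperator H) : QuaternionicOperator H :=
  rpow (star T * T) (1 / 2)

/-- `T` is `p`-hyponormal: `0 < p ≤ 1` and `(T* T) ^ p ≥ (T T*) ^ p`. -/
def IsPHyponormal (p : ℝ) (T : QuaternionicOperator H) : Prop :=
  0 < p ∧ p ≤ 1 ∧ OpLE (rpow (T * star T) p) (rpow (star T * T) p)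

/-- `T = U |T|` is the polar decomposition of `T`: `U` is a partial isometry which is isometric on
the orthogonal complement of `ker |T|` and vanishes on `ker |T|`. -/
structure IsPolarDecomposition (T U : QuaternionicOperator H) : Prop where
  eq_mul : T = U * modulus T
  isometric : ∀ u : H, (∀ v : H, modulus T v = 0 → inner ℍ u v = 0) → ‖U u‖ = ‖u‖
  ker_le : ∀ v : H, modulus T v = 0 → U v = 0

/-- The Aluthge transform `|T|^(1/2) U |T|^(1/2)` of an operator with polar decomposition
`T = U |T|`. -/
def aluthge (T U : QuaternionicOperator H) : QuaternionicOperator H :=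
  rpow (modulus T) (1 / 2) * U * rpow (modulus T) (1 / 2)

end FunctionalCalculus

end QuaternionicOperator

end

/-! Restricting the right scalars to `ℂ` turns `H` into a complex Hilbert space and 𝔅(H) into a
closed real star subalgebra of its operators: those commuting with all right multiplications by
quaternions. Adjoints, order and, by uniqueness, the functional calculus agree
(`opLE_iff_toComplex_le`, `toComplex_funCalc`), which leaves `rpow_aluthge_le`, a statement in a
C*-algebra.

There, with t = ua and d = a^(1/2) u a^(1/2), the element a^(2p+1) separates the two powers. Since
|t*| = u a u*, the bound (dd*)^(p+1/2) ≤ a^(2p+1) is Furuta's inequality (`furuta`) for (tt*)^p ≤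
a^(2p), with both exponents 1/(2p). By Löwner–Heinz it implies (dd*)^(1/2-p) ≤ a^(1-2p). With v = u
a^(1/2), so that d = a^(1/2) v, one has formally v* a^(2p) v = d* a^(2p-1) d ≤ d* (dd*)^(p-1/2) d =
(d*d)^(p+1/2) (`star_mul_rpow_mul_le`), while hyponormality gives v* a^(2p) v ≥ v* (tt*)^p v =
a^(2p+1).

As nothing is assumed invertible, a negative power s^(-γ) is replaced by (s^γ + ε)⁻¹, and the error
is removed because the positive cone is closed. -/

section CStarAlgebra

/-! ### Functional calculus and real powers in a C*-algebra. -/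

variable {A : Type*} [CStarAlgebra A]

/-- Intertwining relations between selfadjoint elements pass to the functional calculus. -/
theorem cfc_mul_eq_mul_cfc {a b x : A} (ha : IsSelfAdjoint a) (hb : IsSelfAdjoint b)
    (h : a * x = x * b) (f : ℝ → ℝ) (hf : ContinuousOn f (spectrum ℝ a ∪ spectrum ℝ b)) :
    cfc f a * x = x * cfc f b := by
  -- On the union of the two spectra a single polynomial approximation serves both `a` and `b`.
  let K : Set ℝ := spectrum ℝ a ∪ spectrum ℝ b
  have : CompactSpace K := isCompact_iff_compactSpace.mp
    ((ContinuousFunctionalCalculus.isCompact_spectrum a).union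
      (ContinuousFunctionalCalculus.isCompact_spectrum b))
  let ia : C(spectrum ℝ a, K) := ⟨Set.inclusion Set.subset_union_left, by fun_prop⟩
  let ib : C(spectrum ℝ b, K) := ⟨Set.inclusion Set.subset_union_right, by fun_prop⟩
  have key : ∀ g : C(K, ℝ), cfcHom ha (g.comp ia) * x = x * cfcHom hb (g.comp ib) := by
    intro g
    have hida : ((ContinuousMap.id ℝ).restrict K).comp ia =
      (ContinuousMap.id ℝ).restrict (spectrum ℝ a) := rfl
    have hidb : ((ContinuousMap.id ℝ).restrict K).comp ib =
      (ContinuousMap.id ℝ).restrict (spectrum ℝ b) := rfl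
    have hid : cfcHom ha (((ContinuousMap.id ℝ).restrict K).comp ia) * x =
        x * cfcHom hb (((ContinuousMap.id ℝ).restrict K).comp ib) := by
      rw [hida, hidb, cfcHom_id, cfcHom_id, h]
    induction g using ContinuousMap.induction_on_of_compact with
    | const r =>
      have e1 : (ContinuousMap.const K r).comp ia = algebraMap ℝ _ r := rfl
      have e2 : (ContinuousMap.const K r).comp ib = algebraMap ℝ _ r := rfl
      rw [e1, e2, AlgHomClass.commutes, AlgHomClass.commutes]
      exact Algebra.commutes r x
    | id => exact hid
    | star_id => exact hid
    | add f g hf hg =>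
      rw [ContinuousMap.add_comp, ContinuousMap.add_comp, map_add, map_add, add_mul, mul_add,
        hf, hg]
    | mul f g hf hg =>
      rw [ContinuousMap.mul_comp, ContinuousMap.mul_comp, map_mul, map_mul, mul_assoc, hg,
        ← mul_assoc, hf, mul_assoc]
    | frequently f hf =>
      have hc : IsClosed {g : C(K, ℝ) | cfcHom ha (g.comp ia) * x = x * cfcHom hb (g.comp ib)} :=
        isClosed_eq
          (((cfcHom_continuous ha).comp ia.continuous_precomp).mul continuous_const)
          (continuous_const.mul ((cfcHom_continuous hb).comp ib.continuous_precomp))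
      exact hc.closure_subset (mem_closure_iff_frequently.mpr hf)
  rw [cfc_apply f a ha (hf.mono Set.subset_union_left),
    cfc_apply f b hb (hf.mono Set.subset_union_right)]
  exact key ⟨_, hf.domRestrict⟩

variable [PartialOrder A] [StarOrderedRing A]

/-- Closedness of the order. A general `z` is allowed because conjugating the error δ · 1 by `v`
turns it into δ · v*v. -/
theorem le_of_forall_pos_le_add_smul {x y z : A} (h : ∀ δ : ℝ, 0 < δ → x ≤ y + δ • z) : x ≤ y := by
  have ht : Filter.Tendsto (fun δ : ℝ => y + δ • z) (nhdsWithin 0 (Set.Ioi 0)) (nhds y) := by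
    have : Filter.Tendsto (fun δ : ℝ => y + δ • z) (nhds 0) (nhds (y + (0 : ℝ) • z)) :=
      Continuous.tendsto (by fun_prop) 0
    rw [zero_smul, add_zero] at this
    exact this.mono_left nhdsWithin_le_nhds
  exact ge_of_tendsto ht (by filter_upwards [self_mem_nhdsWithin] with δ hδ using h δ hδ)

theorem continuousOn_rpow_const_spectrum (s : ℝ) (hs : 0 ≤ s) (S : Set ℝ) :
    ContinuousOn (fun t : ℝ => t ^ s) S :=
  (Real.continuous_rpow_const hs).continuousOn

theorem CFC.rpow_add_of_exponent_nonneg {a : A} (ha : 0 ≤ a) {s t : ℝ} (hs : 0 ≤ s) (ht : 0 ≤ t) :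
    a ^ (s + t) = a ^ s * a ^ t := by
  rw [CFC.rpow_eq_cfc_real, CFC.rpow_eq_cfc_real, CFC.rpow_eq_cfc_real, ← cfc_mul _ _ a
    (continuousOn_rpow_const_spectrum s hs _) (continuousOn_rpow_const_spectrum t ht _)]
  refine cfc_congr fun x hx => ?_
  exact Real.rpow_add_of_nonneg (spectrum_nonneg_of_nonneg ha hx) hs ht

/-! ### Regularised inverse powers. -/

theorem continuousOn_inv_rpow_add {γ ε : ℝ} (hγ : 0 ≤ γ) (hε : 0 < ε) :
    ContinuousOn (fun t : ℝ => (t ^ γ + ε)⁻¹) (Set.Ici 0) := by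
  refine ContinuousOn.inv₀ ((continuousOn_rpow_const_spectrum γ hγ _).add continuousOn_const) ?_
  intro t ht
  have := Real.rpow_nonneg (Set.mem_Ici.mp ht) γ
  positivity

theorem spectrum_subset_Ici {a : A} (ha : 0 ≤ a) : spectrum ℝ a ⊆ Set.Ici 0 :=
  fun _ hx => spectrum_nonneg_of_nonneg ha hx

open Ring in
theorem inverse_rpow_add_eq_cfc {a : A} (ha : 0 ≤ a) {γ ε : ℝ} (hγ : 0 ≤ γ) (hε : 0 < ε) :
    (a ^ γ + algebraMap ℝ A ε)⁻¹ʳ = cfc (fun t : ℝ => (t ^ γ + ε)⁻¹) a := by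
  have hc := continuousOn_rpow_const_spectrum γ hγ (spectrum ℝ a)
  rw [CFC.rpow_eq_cfc_real, ← cfc_add_const ε _ a hc,
    cfc_inv (fun t : ℝ => t ^ γ + ε) a _ (hc.add continuousOn_const)]
  intro x hx
  have := Real.rpow_nonneg (spectrum_subset_Ici ha hx) γ
  positivity

theorem isStrictlyPositive_add_algebraMap {a : A} (ha : 0 ≤ a) {ε : ℝ} (hε : 0 < ε) :
    IsStrictlyPositive (a + algebraMap ℝ A ε) :=
  IsStrictlyPositive.nonneg_add ha (isStrictlyPositive_algebraMap hε)

theorem exists_rpow_le_add_rpow_div {R μ γ δ : ℝ} (hμ : 0 < μ) (hγ : 0 ≤ γ)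
    (hδ : 0 < δ) : ∃ ε > 0, ∀ t : ℝ, 0 ≤ t → t ≤ R → t ^ μ * (1 - t ^ γ * (t ^ γ + ε)⁻¹) ≤ δ := by
  -- The quantity equals t^μ ε / (t^γ + ε). Below the threshold η = δ^(1/μ) the factor t^μ is at
  -- most δ; above it t^γ ≥ η^γ, and ε is chosen to absorb the bound on t^μ.
  have hη : 0 < δ ^ μ⁻¹ := Real.rpow_pos_of_pos hδ _
  set η := δ ^ μ⁻¹ with hη'
  have hημ : η ^ μ = δ := by rw [hη', ← Real.rpow_mul hδ.le, inv_mul_cancel₀ hμ.ne', Real.rpow_one]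
  have hηγ : 0 < η ^ γ := Real.rpow_pos_of_pos hη _
  have hR : 0 < |R| ^ μ + 1 := by positivity
  refine ⟨δ * η ^ γ / (|R| ^ μ + 1), by positivity, fun t ht htR => ?_⟩
  set ε := δ * η ^ γ / (|R| ^ μ + 1) with hε'
  have hε : 0 < ε := by positivity
  have htγ : 0 ≤ t ^ γ := Real.rpow_nonneg ht _
  have htμ : 0 ≤ t ^ μ := Real.rpow_nonneg ht _
  have e : 1 - t ^ γ * (t ^ γ + ε)⁻¹ = ε / (t ^ γ + ε) := by
    have : t ^ γ + ε ≠ 0 := by positivity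
    field_simp
    ring
  rw [e]
  rcases le_total t η with h | h
  · have h1 : ε / (t ^ γ + ε) ≤ 1 := by
      rw [div_le_one (by positivity)]; linarith
    calc t ^ μ * (ε / (t ^ γ + ε)) ≤ t ^ μ * 1 := by gcongr
      _ ≤ δ := by rw [mul_one, ← hημ]; exact Real.rpow_le_rpow ht h hμ.le
  · have h1 : η ^ γ ≤ t ^ γ := Real.rpow_le_rpow hη.le h hγ
    have h2 : t ^ μ ≤ |R| ^ μ := Real.rpow_le_rpow ht (htR.trans (le_abs_self R)) hμ.le
    calc t ^ μ * (ε / (t ^ γ + ε)) ≤ (|R| ^ μ + 1) * (ε / η ^ γ) := by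
          gcongr
          · linarith
          · linarith
      _ = δ := by rw [hε']; field_simp

/-- `a ^ μ` is approximated by its regularisations `a ^ μ * (a ^ γ * (a ^ γ + ε)⁻¹)`. -/
theorem exists_rpow_le_cfc_add {a : A} (ha : 0 ≤ a) {μ γ δ : ℝ} (hμ : 0 < μ) (hγ : 0 ≤ γ)
    (hδ : 0 < δ) : ∃ ε > 0,
      a ^ μ ≤ cfc (fun t : ℝ => t ^ (μ + γ) * (t ^ γ + ε)⁻¹) a + algebraMap ℝ A δ := by
  -- The factor ‖1‖ keeps this a bound for the spectrum even in the zero algebra.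
  obtain ⟨ε, hε, h⟩ := exists_rpow_le_add_rpow_div (R := ‖a‖ * ‖(1 : A)‖) hμ hγ hδ
  refine ⟨ε, hε, ?_⟩
  have hs := spectrum_subset_Ici ha
  have hc : ContinuousOn (fun t : ℝ => t ^ (μ + γ) * (t ^ γ + ε)⁻¹) (spectrum ℝ a) :=
    (continuousOn_rpow_const_spectrum _ (by positivity) _).mul
      ((continuousOn_inv_rpow_add hγ hε).mono hs)
  rw [CFC.rpow_eq_cfc_real, ← cfc_add_const δ _ a hc]
  refine cfc_mono (fun t ht => ?_) (continuousOn_rpow_const_spectrum _ hμ.le _)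
    (hc.add continuousOn_const)
  have ht0 : 0 ≤ t := hs ht
  have h1 := h t ht0 ((le_abs_self t).trans (by
    simpa using spectrum.norm_le_norm_mul_of_mem ht))
  rw [Real.rpow_add_of_nonneg ht0 hμ.le hγ]
  linarith

/-! ### Furuta's inequality and the Aluthge transform in a C*-algebra. -/

theorem cfc_id_mul_mul_star (x : A) {g : ℝ → ℝ} (hg : ContinuousOn g (Set.Ici 0)) :
    cfc (fun t => t * g t) (x * star x) = x * cfc g (star x * x) * star x := by
  have h1 := spectrum_subset_Ici (mul_star_self_nonneg x)
  have h2 := spectrum_subset_Ici (star_mul_self_nonneg x)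
  have h := cfc_mul_eq_mul_cfc (IsSelfAdjoint.star_mul_self x) (IsSelfAdjoint.mul_star_self x)
    (mul_assoc (star x) x (star x)) g (hg.mono (Set.union_subset h2 h1))
  rw [cfc_mul (fun t => t) g _ continuousOn_id (hg.mono h1), cfc_id' ℝ (x * star x), mul_assoc,
    ← h, mul_assoc]

-- Formally (xx*)^(1-γ) = x (x*x)^(-γ) x* ≤ x w⁻¹ x*, since inversion reverses the order; the
-- hypothesis on `z` is the regularised form of x w⁻¹ x* ≤ z.
open Ring in
theorem rpow_mul_star_le {x w z : A} {γ : ℝ} (hγ : 0 ≤ γ) (hγ1 : γ < 1) (hw : 0 ≤ w)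
    (hwx : w ≤ (star x * x) ^ γ)
    (hz : ∀ ε : ℝ, 0 < ε → x * (w + algebraMap ℝ A ε)⁻¹ʳ * star x ≤ z) :
    (x * star x) ^ (1 - γ) ≤ z := by
  refine le_of_forall_pos_le_add_smul (z := 1) fun δ hδ => ?_
  obtain ⟨ε, hε, h⟩ := exists_rpow_le_cfc_add (mul_star_self_nonneg x) (sub_pos.mpr hγ1) hγ hδ
  rw [← Algebra.algebraMap_eq_smul_one]
  refine h.trans (add_le_add_left ?_ _)
  simp only [sub_add_cancel, Real.rpow_one]
  rw [cfc_id_mul_mul_star x (continuousOn_inv_rpow_add hγ hε),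
    ← inverse_rpow_add_eq_cfc (star_mul_self_nonneg x) hγ hε]
  refine le_trans (star_right_conjugate_le_conjugate ?_ x) (hz ε hε)
  exact CStarAlgebra.ringInverse_le_ringInverse (add_le_add_left hwx _)
    (isStrictlyPositive_add_algebraMap hw hε)

open Ring in
theorem cfc_rpow_mul_inv_eq {a : A} (ha : 0 ≤ a) {ρ τ σ ε : ℝ} (hρ : 0 ≤ ρ) (hσ : 0 ≤ σ)
    (hε : 0 < ε) (hτ : τ = ρ + ρ) :
    cfc (fun t : ℝ => t ^ τ * (t ^ σ + ε)⁻¹) a =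
      a ^ ρ * (a ^ σ + algebraMap ℝ A ε)⁻¹ʳ * a ^ ρ := by
  have hs := spectrum_subset_Ici ha
  have hc := continuousOn_rpow_const_spectrum ρ hρ (spectrum ℝ a)
  have hi := (continuousOn_inv_rpow_add hσ hε).mono hs
  rw [inverse_rpow_add_eq_cfc ha hσ hε, CFC.rpow_eq_cfc_real, ← cfc_mul _ _ a hc hi,
    ← cfc_mul (fun t : ℝ => t ^ ρ * (t ^ σ + ε)⁻¹) _ a (hc.mul hi) hc]
  refine cfc_congr fun t ht => ?_
  rw [hτ, Real.rpow_add_of_nonneg (hs ht) hρ hρ]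
  ring

-- Formally v* a^μ v = x* a^(-σ) x ≤ x* (xx*)^(-γ) x = (x*x)^(1-γ), where the first equality uses μ
-- = 2ρ - σ.
open Ring in
theorem star_mul_rpow_mul_le {a v x : A} (ha : 0 ≤ a) {μ σ ρ γ : ℝ} (hμ : 0 < μ) (hσ : 0 ≤ σ)
    (hρ : μ + σ = ρ + ρ) (hγ : 0 ≤ γ) (hγ1 : γ ≤ 1) (hx : x = a ^ ρ * v)
    (h : (x * star x) ^ γ ≤ a ^ σ) : star v * a ^ μ * v ≤ (star x * x) ^ (1 - γ) := by
  refine le_of_forall_pos_le_add_smul (z := star v * v) fun δ hδ => ?_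
  obtain ⟨ε, hε, h1⟩ := exists_rpow_le_cfc_add ha hμ hσ hδ
  have hsa : star (a ^ ρ) = a ^ ρ := (CFC.rpow_nonneg.isSelfAdjoint : IsSelfAdjoint (a ^ ρ))
  rw [cfc_rpow_mul_inv_eq ha (by linarith) hσ hε hρ] at h1
  have h2 := star_left_conjugate_le_conjugate h1 v
  have h3 : star v * (a ^ ρ * (a ^ σ + algebraMap ℝ A ε)⁻¹ʳ * a ^ ρ + algebraMap ℝ A δ) * v =
      star x * (a ^ σ + algebraMap ℝ A ε)⁻¹ʳ * x + δ • (star v * v) := by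
    rw [hx, star_mul, hsa, Algebra.algebraMap_eq_smul_one δ]
    simp only [mul_add, add_mul, mul_smul_comm, smul_mul_assoc, mul_one, mul_assoc]
  rw [h3] at h2
  refine h2.trans (add_le_add_left ?_ _)
  have h4 : (a ^ σ + algebraMap ℝ A ε)⁻¹ʳ ≤ ((x * star x) ^ γ + algebraMap ℝ A ε)⁻¹ʳ :=
    CStarAlgebra.ringInverse_le_ringInverse (add_le_add_left h _)
      (isStrictlyPositive_add_algebraMap CFC.rpow_nonneg hε)
  refine (star_left_conjugate_le_conjugate h4 x).trans ?_
  rw [inverse_rpow_add_eq_cfc (mul_star_self_nonneg x) hγ hε]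
  have h5 := cfc_id_mul_mul_star (star x) (continuousOn_inv_rpow_add hγ hε)
  rw [star_star] at h5
  have hs := spectrum_subset_Ici (star_mul_self_nonneg x)
  rw [← h5, CFC.rpow_eq_cfc_real (star_mul_self_nonneg x)]
  refine cfc_mono (fun t ht => ?_)
    (continuousOn_id.mul ((continuousOn_inv_rpow_add hγ hε).mono hs))
    (continuousOn_rpow_const_spectrum _ (by linarith) _)
  have ht0 : 0 ≤ t := hs ht
  have e : t = t ^ (1 - γ) * t ^ γ := by
    rw [← Real.rpow_add_of_nonneg ht0 (by linarith) hγ, sub_add_cancel, Real.rpow_one]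
  have htγ := Real.rpow_nonneg ht0 γ
  have htγ' := Real.rpow_nonneg ht0 (1 - γ)
  rw [← div_eq_mul_inv, div_le_iff₀ (by positivity)]
  nlinarith

/-- Put x = a^(r/2) b^(p/2) and γ = (p-1)/(p+r). As r ≤ 1, Löwner–Heinz gives x*x ≥ b^(p+r), and
again (x*x)^γ ≥ b^(p-1). Hence formally (xx*)^(1-γ) ≤ x b^(1-p) x* = a^(r/2) b a^(r/2) ≤ a^(1+r). -/
theorem furuta_of_le_one {a b : A} (hb : 0 ≤ b) (hab : b ≤ a) {p r : ℝ} (hp : 1 ≤ p)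
    (hr : 0 ≤ r) (hr1 : r ≤ 1) :
    (a ^ (r / 2) * b ^ p * a ^ (r / 2)) ^ ((1 + r) / (p + r)) ≤ a ^ (1 + r) := by
  have ha : 0 ≤ a := hb.trans hab
  have hsa : star (a ^ (r / 2)) = a ^ (r / 2) :=
    (CFC.rpow_nonneg.isSelfAdjoint : IsSelfAdjoint (a ^ (r / 2)))
  have hsb : star (b ^ (p / 2)) = b ^ (p / 2) :=
    (CFC.rpow_nonneg.isSelfAdjoint : IsSelfAdjoint (b ^ (p / 2)))
  have ea : a ^ (r / 2) * a ^ (r / 2) = a ^ r := by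
    rw [← CFC.rpow_add_of_exponent_nonneg ha (by positivity) (by positivity), add_halves]
  have eb : b ^ (p / 2) * b ^ (p / 2) = b ^ p := by
    rw [← CFC.rpow_add_of_exponent_nonneg hb (by positivity) (by positivity), add_halves]
  set x := a ^ (r / 2) * b ^ (p / 2) with hx
  have h1 : x * star x = a ^ (r / 2) * b ^ p * a ^ (r / 2) := by
    rw [hx, star_mul, hsa, hsb, ← eb]; simp only [mul_assoc]
  have h2 : star x * x = b ^ (p / 2) * a ^ r * b ^ (p / 2) := by
    rw [hx, star_mul, hsa, hsb, ← ea]; simp only [mul_assoc]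
  have h3 : b ^ (p + r) ≤ star x * x := by
    have h := conjugate_le_conjugate_of_nonneg (CFC.rpow_le_rpow ⟨hr, hr1⟩ hab)
      (CFC.rpow_nonneg : 0 ≤ b ^ (p / 2))
    rw [h2]
    refine le_trans (le_of_eq ?_) h
    rw [← CFC.rpow_add_of_exponent_nonneg hb (by positivity) (by positivity),
      ← CFC.rpow_add_of_exponent_nonneg hb (by positivity) (by positivity)]
    congr 1; ring
  have hγ : 0 ≤ (p - 1) / (p + r) := div_nonneg (by linarith) (by linarith)
  have hγ1 : (p - 1) / (p + r) < 1 := by rw [div_lt_one (by linarith)]; linarith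
  have h4 : b ^ (p - 1) ≤ (star x * x) ^ ((p - 1) / (p + r)) := by
    have h := CFC.rpow_le_rpow ⟨hγ, hγ1.le⟩ h3
    rwa [CFC.rpow_rpow_of_exponent_nonneg _ _ _ (by linarith) hγ,
      mul_div_cancel₀ _ (by linarith : p + r ≠ 0)] at h
  have e : (1 + r) / (p + r) = 1 - (p - 1) / (p + r) := by
    rw [eq_sub_iff_add_eq, ← add_div, div_eq_one_iff_eq (by linarith)]; ring
  rw [← h1, e]
  refine rpow_mul_star_le hγ hγ1 CFC.rpow_nonneg h4 fun ε hε => ?_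
  have h5 : a ^ (1 + r) = a ^ (r / 2) * a * a ^ (r / 2) := by
    nth_rewrite 3 [← CFC.rpow_one a]
    rw [← CFC.rpow_add_of_exponent_nonneg ha (by positivity) (by positivity),
      ← CFC.rpow_add_of_exponent_nonneg ha (by positivity) (by positivity)]
    congr 1; ring
  rw [hx, star_mul, hsa, hsb, h5]
  have h6 := cfc_rpow_mul_inv_eq hb (by positivity : 0 ≤ p / 2) (by linarith : 0 ≤ p - 1) hε
    (add_halves p).symm
  have h7 : cfc (fun t : ℝ => t ^ p * (t ^ (p - 1) + ε)⁻¹) b ≤ b := by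
    have hs := spectrum_subset_Ici hb
    conv_rhs => rw [← cfc_id' ℝ b]
    refine cfc_mono (fun t ht => ?_)
      ((continuousOn_rpow_const_spectrum _ (by linarith) _).mul
        ((continuousOn_inv_rpow_add (by linarith) hε).mono hs)) continuousOn_id
    have ht0 : 0 ≤ t := hs ht
    have e : t ^ p = t * t ^ (p - 1) := by
      conv_rhs => enter [1]; rw [← Real.rpow_one t]
      rw [← Real.rpow_add_of_nonneg ht0 (by linarith) (by linarith), add_sub_cancel]
    have htp := Real.rpow_nonneg ht0 (p - 1)
    rw [← div_eq_mul_inv, div_le_iff₀ (by positivity), e]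
    nlinarith
  rw [h6] at h7
  have h8 := conjugate_le_conjugate_of_nonneg (h7.trans hab)
    (CFC.rpow_nonneg : 0 ≤ a ^ (r / 2))
  simpa only [mul_assoc] using h8

/-- Furuta's inequality. -/
theorem furuta {a b : A} (hb : 0 ≤ b) (hab : b ≤ a) {p r : ℝ} (hp : 1 ≤ p) (hr : 0 ≤ r) :
    (a ^ (r / 2) * b ^ p * a ^ (r / 2)) ^ ((1 + r) / (p + r)) ≤ a ^ (1 + r) := by
  have ha : 0 ≤ a := hb.trans hab
  obtain ⟨n, hn⟩ := pow_unbounded_of_one_lt (1 + r) (one_lt_two (α := ℝ))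
  induction n generalizing r with
  | zero => exact furuta_of_le_one hb hab hp hr (by norm_num at hn; linarith)
  | succ n ih =>
    rcases le_or_gt r 1 with hr1 | hr1
    · exact furuta_of_le_one hb hab hp hr hr1
    -- The inequality for `s` is itself of the form b' ≤ a' with a' = a^(1+s). The case r = 1
    -- applied to it with exponent (p+s)/(1+s) gives the inequality for 2s + 1; the induction works
    -- because 1 + r = 2(1 + s).
    · obtain ⟨s, hs⟩ : ∃ s, s = (r - 1) / 2 := ⟨_, rfl⟩
      obtain rfl : r = 2 * s + 1 := by linarith
      have hs0 : 0 < s := by linarith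
      have h1 := ih hs0.le (by rw [pow_succ] at hn; linarith)
      have hp1 : 1 ≤ (p + s) / (1 + s) := by rw [le_div_iff₀ (by linarith)]; linarith
      have h2 := furuta_of_le_one CFC.rpow_nonneg h1 hp1 zero_le_one le_rfl
      have hc : 0 ≤ a ^ (s / 2) * b ^ p * a ^ (s / 2) :=
        conjugate_nonneg_of_nonneg CFC.rpow_nonneg CFC.rpow_nonneg
      rw [CFC.rpow_rpow_of_exponent_nonneg _ _ _ (by positivity) (by positivity),
        CFC.rpow_rpow_of_exponent_nonneg _ _ _ (by positivity) (by positivity),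
        CFC.rpow_rpow_of_exponent_nonneg _ _ _ (by positivity) (by positivity)] at h2
      have e1 : (1 + s) / (p + s) * ((p + s) / (1 + s)) = 1 := by field_simp
      rw [e1, CFC.rpow_one _ hc] at h2
      have e2 : a ^ ((2 * s + 1) / 2) = a ^ ((1 + s) * (1 / 2)) * a ^ (s / 2) := by
        rw [← CFC.rpow_add_of_exponent_nonneg ha (by positivity) (by positivity)]
        congr 1; ring
      have e3 : a ^ ((2 * s + 1) / 2) = a ^ (s / 2) * a ^ ((1 + s) * (1 / 2)) := by
        rw [← CFC.rpow_add_of_exponent_nonneg ha (by positivity) (by positivity)]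
        congr 1; ring
      have e4 : (1 + 1) / ((p + s) / (1 + s) + 1) = (1 + (2 * s + 1)) / (p + (2 * s + 1)) := by
        have : p + s + (1 + s) ≠ 0 := by positivity
        have : p + (2 * s + 1) ≠ 0 := by positivity
        field_simp
        ring
      have e5 : (1 + s) * (1 + 1) = 1 + (2 * s + 1) := by ring
      rw [e4, e5] at h2
      nth_rewrite 1 [e2]
      rw [e3]
      simpa only [mul_assoc] using h2

/-- The Aluthge transform of a `p`-hyponormal element with polar decomposition `t = u * a` is
`p + 1 / 2`-hyponormal. -/
theorem rpow_aluthge_le {t u a : A} {p : ℝ} (hp : 0 < p) (hp2 : p < 1 / 2)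
    (ha : a = (star t * t) ^ (1 / 2 : ℝ)) (ht : t = u * a) (hua : star u * u * a = a)
    (h : (t * star t) ^ p ≤ (star t * t) ^ p) :
    let d := a ^ (1 / 2 : ℝ) * u * a ^ (1 / 2 : ℝ)
    (d * star d) ^ (p + 1 / 2) ≤ (star d * d) ^ (p + 1 / 2) := by
  intro d
  have ha0 : 0 ≤ a := ha ▸ CFC.rpow_nonneg
  have hsa : star a = a := ha0.isSelfAdjoint
  have hsr : star (a ^ (1 / 2 : ℝ)) = a ^ (1 / 2 : ℝ) :=
    (CFC.rpow_nonneg.isSelfAdjoint : IsSelfAdjoint (a ^ (1 / 2 : ℝ)))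
  have hau : a * (star u * u) = a := by
    have := congrArg star hua
    simpa only [star_mul, star_star, hsa] using this
  have haq : ∀ q : ℝ, 0 ≤ q → (star t * t) ^ q = a ^ (2 * q) := fun q hq => by
    rw [ha, CFC.rpow_rpow_of_exponent_nonneg _ _ _ (by norm_num) (by positivity)
      (star_mul_self_nonneg t)]
    congr 1; ring
  have hrr : a ^ (1 / 2 : ℝ) * a ^ (1 / 2 : ℝ) = a := by
    rw [← CFC.rpow_add_of_exponent_nonneg ha0 (by norm_num) (by norm_num)]
    norm_num [CFC.rpow_one a]
  have huq : ∀ q : ℝ, 0 < q → star u * u * a ^ q = a ^ q := fun q hq => by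
    -- `1 - star u * u` intertwines 0 and `a`; since 0^q = 0 for q > 0, it also annihilates a^q.
    have h0 : (0 : A) * (1 - star u * u) = (1 - star u * u) * a := by
      rw [zero_mul, sub_mul, one_mul, hua, sub_self]
    have h1 := cfc_mul_eq_mul_cfc (.zero A) ha0.isSelfAdjoint h0 (fun s => s ^ q)
      (continuousOn_rpow_const_spectrum q hq.le _)
    rw [← CFC.rpow_eq_cfc_real ha0, ← CFC.rpow_eq_cfc_real le_rfl, ← CFC.rpow_eq_pow (a := (0 : A)),
      CFC.zero_rpow hq.ne', zero_mul, sub_mul, one_mul] at h1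
    exact (sub_eq_zero.mp h1.symm).symm
  have hut : ∀ q : ℝ, 0 ≤ q → (t * star t) ^ q * u = u * (star t * t) ^ q := fun q hq => by
    have hst : star t * t = a * a := by
      rw [ht, star_mul, hsa]
      calc a * star u * (u * a) = a * (star u * u) * a := by simp only [mul_assoc]
        _ = a * a := by rw [hau]
    have h0 : (t * star t) * u = u * (star t * t) := by
      rw [hst, ht, star_mul, hsa]
      calc u * a * (a * star u) * u = u * (a * (a * (star u * u))) := by simp only [mul_assoc]
        _ = u * (a * a) := by rw [hau]
    rw [CFC.rpow_eq_cfc_real (mul_star_self_nonneg t), CFC.rpow_eq_cfc_real (star_mul_self_nonneg t)]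
    exact cfc_mul_eq_mul_cfc (.mul_star_self t) (.star_mul_self t) h0 _
      (continuousOn_rpow_const_spectrum q hq _)
  have habs : (t * star t) ^ (1 / 2 : ℝ) = u * a * star u := by
    have hn : 0 ≤ u * a * star u := star_right_conjugate_nonneg ha0 u
    have h1 : (u * a * star u) ^ (2 : ℝ) = t * star t := by
      have := CFC.rpow_natCast (u * a * star u) 2
      rw [Nat.cast_ofNat] at this
      rw [this, pow_two, ht, star_mul, hsa]
      calc u * a * star u * (u * a * star u) = u * (a * (star u * u)) * (a * star u) := by
            simp only [mul_assoc]
        _ = u * a * (a * star u) := by rw [hau]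
    rw [← h1, CFC.rpow_rpow_of_exponent_nonneg _ _ _ (by norm_num) (by norm_num)]
    norm_num [CFC.rpow_one _ hn]
  have hdd : d * star d = a ^ (1 / 2 : ℝ) * (t * star t) ^ (1 / 2 : ℝ) * a ^ (1 / 2 : ℝ) := by
    simp only [d, star_mul, hsr, habs]
    calc a ^ (1 / 2 : ℝ) * u * a ^ (1 / 2 : ℝ) * (a ^ (1 / 2 : ℝ) * (star u * a ^ (1 / 2 : ℝ)))
        = a ^ (1 / 2 : ℝ) * u * (a ^ (1 / 2 : ℝ) * a ^ (1 / 2 : ℝ)) * star u * a ^ (1 / 2 : ℝ) := by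
          simp only [mul_assoc]
      _ = _ := by rw [hrr]; simp only [mul_assoc]
  have hfur := furuta CFC.rpow_nonneg h (p := 1 / (2 * p)) (r := 1 / (2 * p))
    (by rw [le_div_iff₀ (by positivity)]; linarith) (by positivity)
  rw [haq p hp.le,
    CFC.rpow_rpow_of_exponent_nonneg a _ _ (by positivity) (by positivity) ha0,
    CFC.rpow_rpow_of_exponent_nonneg (t * star t) _ _ (by positivity) (by positivity)
      (mul_star_self_nonneg t),
    CFC.rpow_rpow_of_exponent_nonneg a _ _ (by positivity) (by positivity) ha0,
    show 2 * p * (1 / (2 * p) / 2) = 1 / 2 by field_simp,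
    show p * (1 / (2 * p)) = 1 / 2 by field_simp,
    show (1 + 1 / (2 * p)) / (1 / (2 * p) + 1 / (2 * p)) = p + 1 / 2 by field_simp; ring,
    show 2 * p * (1 + 1 / (2 * p)) = 2 * p + 1 by field_simp, ← hdd] at hfur
  refine hfur.trans ?_
  -- This exponent θ satisfies (p + 1/2)θ = 1/2 - p.
  have hθ0 : 0 ≤ (1 / 2 - p) / (p + 1 / 2) := div_nonneg (by linarith) (by linarith)
  have hθ1 : (1 / 2 - p) / (p + 1 / 2) ≤ 1 := by rw [div_le_one (by linarith)]; linarith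
  have hlow := CFC.rpow_le_rpow ⟨hθ0, hθ1⟩ hfur
  rw [CFC.rpow_rpow_of_exponent_nonneg _ _ _ (by positivity) hθ0 (mul_star_self_nonneg d),
    CFC.rpow_rpow_of_exponent_nonneg _ _ _ (by positivity) hθ0 ha0,
    mul_div_cancel₀ _ (by linarith : p + 1 / 2 ≠ 0),
    show (2 * p + 1) * ((1 / 2 - p) / (p + 1 / 2)) = 1 - 2 * p by field_simp] at hlow
  have hmain := star_mul_rpow_mul_le (v := u * a ^ (1 / 2 : ℝ)) (x := d) ha0
    (by positivity : 0 < 2 * p) (by linarith : 0 ≤ 1 - 2 * p)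
    (by ring : 2 * p + (1 - 2 * p) = 1 / 2 + 1 / 2) (by linarith : 0 ≤ 1 / 2 - p) (by linarith)
    (mul_assoc _ _ _) hlow
  rw [show 1 - (1 / 2 - p) = p + 1 / 2 by ring] at hmain
  refine le_trans ?_ hmain
  rw [haq p hp.le] at h
  refine le_trans (le_of_eq ?_) (star_left_conjugate_le_conjugate h (u * a ^ (1 / 2 : ℝ)))
  rw [star_mul, hsr]
  calc a ^ (2 * p + 1) = a ^ (1 / 2 : ℝ) * a ^ (2 * p) * a ^ (1 / 2 : ℝ) := by
        rw [← CFC.rpow_add_of_exponent_nonneg ha0 (by positivity) (by positivity),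
          ← CFC.rpow_add_of_exponent_nonneg ha0 (by positivity) (by positivity)]
        congr 1; ring
    _ = a ^ (1 / 2 : ℝ) * (star u * u * a ^ (2 * p)) * a ^ (1 / 2 : ℝ) := by
        rw [huq _ (by positivity)]
    _ = a ^ (1 / 2 : ℝ) * (star u * ((t * star t) ^ p * u)) * a ^ (1 / 2 : ℝ) := by
        rw [hut p hp.le, haq p hp.le, mul_assoc (star u)]
    _ = _ := by simp only [mul_assoc]

end CStarAlgebra

/-! ### The underlying complex Hilbert space. -/

noncomputable section

/-- The space `H` regarded as a complex vector space, by restriction of the right scalars along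
`ℂ → ℍ`. -/
def ComplexSpace (H : Type*) : Type _ := H

namespace ComplexSpace

open RightQuaternionicInnerProductSpace

variable {H : Type*} [NormedAddCommGroup H] [Module ℍᵐᵒᵖ H]

instance : NormedAddCommGroup (ComplexSpace H) := inferInstanceAs (NormedAddCommGroup H)

instance [CompleteSpace H] : CompleteSpace (ComplexSpace H) := inferInstanceAs (CompleteSpace H)

instance : Module ℍᵐᵒᵖ (ComplexSpace H) := inferInstanceAs (Module ℍᵐᵒᵖ H)

instance : Module ℂ (ComplexSpace H) :=
  Module.compHom (ComplexSpace H) (Quaternion.ofComplex.toRingHom.toOpposite fun z w => by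
    rw [commute_iff_eq, ← map_mul, ← map_mul, mul_comm])

theorem complex_smul_def (z : ℂ) (u : ComplexSpace H) :
    z • u = MulOpposite.op (z : ℍ) • u := rfl

variable [RightQuaternionicInnerProductSpace H]

instance : Inner ℍ (ComplexSpace H) := inferInstanceAs (Inner ℍ H)

theorem norm_op_smul (q : ℍ) (u : H) : ‖MulOpposite.op q • u‖ = ‖q‖ * ‖u‖ := by
  have h1 := qinner_self_eq (MulOpposite.op q • u)
  rw [qinner_smul_right, qinner_smul_left, qinner_self_eq, mul_assoc, Quaternion.coe_commutes,
    ← mul_assoc, Quaternion.star_mul_self, ← Quaternion.coe_mul, Quaternion.coe_inj,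
    Quaternion.normSq_eq_norm_mul_self] at h1
  rw [← abs_of_nonneg (norm_nonneg (MulOpposite.op q • u)),
    ← abs_of_nonneg (by positivity : 0 ≤ ‖q‖ * ‖u‖), ← sq_eq_sq_iff_abs_eq_abs, ← h1]
  ring

instance : ContinuousConstSMul ℍᵐᵒᵖ (ComplexSpace H) where
  continuous_const_smul q :=
    AddMonoidHomClass.continuous_of_bound (DistribSMul.toAddMonoidHom (ComplexSpace H) q)
      ‖q.unop‖ fun u => (norm_op_smul (H := H) q.unop u).le

instance : InnerProductSpace ℂ (ComplexSpace H) where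
  norm_smul_le z u := by
    refine le_of_eq ((norm_op_smul (H := H) (z : ℍ) u).trans ?_)
    congr 1
    rw [← sq_eq_sq₀ (norm_nonneg _) (norm_nonneg _), sq, sq, ← Quaternion.normSq_eq_norm_mul_self,
      ← sq, Complex.sq_norm, Quaternion.normSq_def', Complex.normSq_apply]
    simp
    ring
  -- The projection of ℍ = ℂ ⊕ ℂj onto ℂ is left ℂ-linear and fixes the real number ⟨u, u⟩, so this
  -- is sesquilinear with the same norm.
  inner u v := ⟨(inner ℍ u v).re, (inner ℍ u v).imI⟩
  norm_sq_eq_re_inner u := by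
    change ‖u‖ ^ 2 = (inner ℍ u u).re
    exact (congrArg (fun q : ℍ => q.re) (qinner_self_eq (H := H) u)).symm
  conj_inner_symm u v := by
    rw [show inner ℍ v u = star (inner ℍ u v) from (star_inner (H := H) u v).symm]
    apply Complex.ext <;> simp
  add_left u v w := by
    rw [show inner ℍ (u + v) w = inner ℍ u w + inner ℍ v w from qinner_add_left (H := H) u v w]
    apply Complex.ext <;> simp
  smul_left u v z := by
    rw [show inner ℍ (z • u) v = star (z : ℍ) * inner ℍ u v from
      qinner_smul_left (H := H) u v (z : ℍ)]
    apply Complex.ext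
    · simp [Quaternion.re_mul]
    · simp [Quaternion.imI_mul]

theorem complex_inner_def (u v : ComplexSpace H) :
    inner ℂ u v = ⟨(inner ℍ u v).re, (inner ℍ u v).imI⟩ := rfl

end ComplexSpace

/-! ### Quaternionic operators inside the complex ones. -/

namespace QuaternionicOperator

open RightQuaternionicInnerProductSpace ComplexSpace

section ComplexLinear

variable {H : Type*} [NormedAddCommGroup H] [Module ℍᵐᵒᵖ H]

/-- A right quaternionic linear operator, as a complex linear operator. -/
def toComplexCLM (T : QuaternionicOperator H) : ComplexSpace H →L[ℂ] ComplexSpace H where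
  toFun := T
  map_add' := T.map_add
  map_smul' z u := T.map_smul (MulOpposite.op (z : ℍ)) u
  cont := T.continuous

theorem toComplexCLM_op_smul (T : QuaternionicOperator H) (q : ℍᵐᵒᵖ) (u : ComplexSpace H) :
    toComplexCLM T (q • u) = q • toComplexCLM T u := T.map_smul q u

theorem toComplexCLM_injective :
    Function.Injective (toComplexCLM : QuaternionicOperator H → _) := fun S T h => by
  ext u
  exact DFunLike.congr_fun h u

theorem exists_toComplexCLM_eq {S : ComplexSpace H →L[ℂ] ComplexSpace H}
    (hS : ∀ (q : ℍᵐᵒᵖ) (u : ComplexSpace H), S (q • u) = q • S u) :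
    ∃ T : QuaternionicOperator H, toComplexCLM T = S :=
  ⟨{ toFun := fun u : H => S u
     map_add' := S.map_add
     map_smul' := hS
     cont := S.continuous }, rfl⟩

end ComplexLinear

variable {H : Type*} [NormedAddCommGroup H] [Module ℍᵐᵒᵖ H] [RightQuaternionicInnerProductSpace H]
  [CompleteSpace H]

/-- The embedding of the quaternionic operators into the complex linear operators. -/
def toComplex :
    QuaternionicOperator H →⋆ₐ[ℝ] (ComplexSpace H →L[ℂ] ComplexSpace H) where
  toFun := toComplexCLM
  map_one' := rfl
  map_mul' _ _ := rfl
  map_zero' := rfl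
  map_add' _ _ := rfl
  commutes' r := by
    ext u
    change MulOpposite.op (r : ℍ) • u = _
    rw [Algebra.algebraMap_eq_smul_one]
    change _ = ((r : ℂ) • u : ComplexSpace H)
    rw [complex_smul_def, Quaternion.coeComplex_coe]
  map_star' T := by
    rw [ContinuousLinearMap.star_eq_adjoint, ContinuousLinearMap.eq_adjoint_iff]
    intro u v
    have h : inner ℍ (adjoint T u) v = inner ℍ u (T v) := inner_adjoint_left T u v
    have h' : ∀ a b a' b' : ComplexSpace H, inner ℍ a b = inner ℍ a' b' →
        inner ℂ a b = inner ℂ a' b' := fun a b a' b' e => by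
      rw [complex_inner_def, complex_inner_def, e]
    exact h' _ _ _ _ h

theorem toComplex_injective :
    Function.Injective (toComplex : QuaternionicOperator H → _) := toComplexCLM_injective

/-- The range of `toComplex` consists of the operators commuting with all right multiplications. -/
theorem mem_range_toComplex {S : ComplexSpace H →L[ℂ] ComplexSpace H} :
    S ∈ (toComplex (H := H)).range ↔
      ∀ (q : ℍᵐᵒᵖ) (u : ComplexSpace H), S (q • u) = q • S u := by
  constructor
  · rintro ⟨T, rfl⟩ q u
    exact toComplexCLM_op_smul T q u
  · exact exists_toComplexCLM_eq

theorem isClosed_range_toComplex :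
    IsClosed ((toComplex (H := H)).range : Set (ComplexSpace H →L[ℂ] ComplexSpace H)) := by
  have : ((toComplex (H := H)).range : Set (ComplexSpace H →L[ℂ] ComplexSpace H)) =
      ⋂ (q : ℍᵐᵒᵖ) (u : ComplexSpace H), {S | S (q • u) = q • S u} := by
    ext S
    simp only [Set.mem_iInter]
    exact mem_range_toComplex
  rw [this]
  refine isClosed_iInter fun q => isClosed_iInter fun u => isClosed_eq ?_ ?_
  · exact (ContinuousLinearMap.apply ℂ _ (q • u)).continuous
  · exact (ContinuousLinearMap.apply ℂ _ u).continuous.const_smul q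

/-- The inverse of a map commuting with right multiplications commutes with them too. -/
theorem isUnit_of_isUnit_toComplex {T : QuaternionicOperator H} (h : IsUnit (toComplex T)) :
    IsUnit T := by
  obtain ⟨v, hv1, hv2⟩ := isUnit_iff_exists.mp h
  obtain ⟨V, rfl⟩ : v ∈ (toComplex (H := H)).range := by
    refine mem_range_toComplex.mpr fun q u => ?_
    have h1 : ∀ w, toComplex T (v w) = w := fun w => DFunLike.congr_fun hv1 w
    have h2 : ∀ w, v (toComplex T w) = w := fun w => DFunLike.congr_fun hv2 w
    calc v (q • u) = v (q • toComplex T (v u)) := by rw [h1]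
      _ = v (toComplex T (q • v u)) := congrArg v (toComplexCLM_op_smul T q (v u)).symm
      _ = q • v u := h2 _
  refine isUnit_iff_exists.mpr ⟨V, toComplex_injective ?_, toComplex_injective ?_⟩
  · rw [map_mul, map_one]; exact hv1
  · rw [map_mul, map_one]; exact hv2

theorem opLE_iff_toComplex_le {S T : QuaternionicOperator H} :
    OpLE S T ↔ toComplex S ≤ toComplex T := by
  rw [OpLE, ContinuousLinearMap.le_def, ← map_sub]
  generalize T - S = R
  constructor
  · intro h
    rw [ContinuousLinearMap.isPositive_iff_complex]
    intro u
    obtain ⟨r, hr, e⟩ := h u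
    have e' : inner ℍ (toComplex R u) u = (r : ℍ) := e
    rw [complex_inner_def, e']
    simpa [Complex.ext_iff] using hr
  · intro h u
    -- Complex positivity sees only the 1 and i components of ⟨Ru, u⟩; selfadjointness over ℍ
    -- removes the j and k components.
    have hs : adjoint R = R := by
      refine toComplex_injective ?_
      rw [← star_eq_adjoint, map_star]
      exact h.isSelfAdjoint
    have h1 : star (inner ℍ (R u) u) = inner ℍ (R u) u := by
      rw [star_inner, ← inner_adjoint_left, hs]
    refine ⟨(inner ℍ (R u) u).re, ?_, ?_⟩
    · have := h.re_inner_nonneg_left u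
      exact this
    · exact Quaternion.star_eq_self.mp h1

theorem isPositive_iff_toComplex_nonneg {T : QuaternionicOperator H} :
    IsPositive T ↔ 0 ≤ toComplex T := by
  have := opLE_iff_toComplex_le (S := 0) (T := T)
  rwa [map_zero, OpLE, sub_zero] at this

theorem norm_toComplex (T : QuaternionicOperator H) :
    ‖toComplex T‖ = ‖(T.restrictScalars ℝ : H →L[ℝ] H)‖ :=
  le_antisymm
    (ContinuousLinearMap.opNorm_le_bound _
      (norm_nonneg (T.restrictScalars ℝ : H →L[ℝ] H)) fun u =>
      (T.restrictScalars ℝ : H →L[ℝ] H).le_opNorm u)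
    (ContinuousLinearMap.opNorm_le_bound _ (norm_nonneg _) fun u =>
      (toComplex T).le_opNorm u)

theorem continuous_toComplex_comp_iff {X : Type*} [TopologicalSpace X]
    {F : X → QuaternionicOperator H} :
    Continuous (fun x => toComplex (F x)) ↔
      Continuous (fun x => ((F x).restrictScalars ℝ : H →L[ℝ] H)) := by
  have h : ∀ x y : X, dist (toComplex (F x)) (toComplex (F y)) =
      dist ((F x).restrictScalars ℝ : H →L[ℝ] H) ((F y).restrictScalars ℝ : H →L[ℝ] H) :=
    fun x y => by
      rw [dist_eq_norm, ← map_sub, norm_toComplex]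
      exact (dist_eq_norm ((F x).restrictScalars ℝ : H →L[ℝ] H) ((F y).restrictScalars ℝ)).symm
  refine continuous_iff_continuous_dist.trans (Iff.trans ?_
    (continuous_iff_continuous_dist
      (f := fun x => ((F x).restrictScalars ℝ : H →L[ℝ] H))).symm)
  simp only [h]

/-! ### Spherical spectrum and functional calculus. -/

theorem toComplex_sphericalDelta (T : QuaternionicOperator H) (q : ℍ) :
    toComplex (sphericalDelta T q) =
      toComplex T ^ 2 - (2 * q.re) • toComplex T + (‖q‖ ^ 2) • 1 := by
  simp only [sphericalDelta, map_add, map_sub, map_smul, map_pow, map_one]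

theorem sq_sub_smul_add_smul_one {A : Type*} [Ring A] [Algebra ℝ A] (a : A) (x : ℝ) :
    a ^ 2 - (2 * x) • a + (x ^ 2) • 1 = (algebraMap ℝ A x - a) * (algebraMap ℝ A x - a) := by
  simp only [Algebra.smul_def, map_mul, map_ofNat, map_pow, mul_one]
  have h := Algebra.commutes x a
  generalize algebraMap ℝ A x = r at h ⊢
  have e : (r - a) * (r - a) = r ^ 2 - r * a - a * r + a ^ 2 := by noncomm_ring
  rw [e, ← h, mul_assoc, two_mul]
  abel

theorem coe_mem_sphericalSpectrum {T : QuaternionicOperator H} {x : ℝ}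
    (hx : x ∈ spectrum ℝ (toComplex T)) : (x : ℍ) ∈ sphericalSpectrum T := by
  intro h
  have h1 := h.map toComplex
  have e : toComplex (sphericalDelta T x) =
      (algebraMap ℝ _ x - toComplex T) * (algebraMap ℝ _ x - toComplex T) := by
    rw [toComplex_sphericalDelta, Quaternion.re_coe, Quaternion.norm_coe, Real.norm_eq_abs, sq_abs,
      sq_sub_smul_add_smul_one]
  rw [e] at h1
  exact hx ((Commute.refl _).isUnit_mul_iff.mp h1).1

theorem re_mem_spectrum {T : QuaternionicOperator H} (hT : IsSelfAdjoint (toComplex T)) {q : ℍ}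
    (hq : q ∈ sphericalSpectrum T) : q.re ∈ spectrum ℝ (toComplex T) := by
  by_contra hre
  refine hq (isUnit_of_isUnit_toComplex ?_)
  have e : toComplex (sphericalDelta T q) =
      cfc (fun t : ℝ => t ^ 2 - (2 * q.re) * t + ‖q‖ ^ 2) (toComplex T) := by
    rw [toComplex_sphericalDelta,
      cfc_add_const (‖q‖ ^ 2) (fun t : ℝ => t ^ 2 - (2 * q.re) * t) _ (by fun_prop) hT,
      cfc_sub (fun t : ℝ => t ^ 2) (fun t : ℝ => (2 * q.re) * t), cfc_pow_id _ _ hT,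
      cfc_const_mul_id _ _ hT, Algebra.algebraMap_eq_smul_one]
  rw [e, isUnit_cfc_iff _ _ (by fun_prop) hT]
  intro x hx h0
  have h1 : ‖q‖ ^ 2 = q.re ^ 2 + q.imI ^ 2 + q.imJ ^ 2 + q.imK ^ 2 := by
    rw [sq, ← Quaternion.normSq_eq_norm_mul_self, Quaternion.normSq_def']
  -- The polynomial is (t - Re q)² + |Im q|², so a zero forces t = Re q.
  have h2 : (x - q.re) ^ 2 = 0 := by
    nlinarith [sq_nonneg (x - q.re), sq_nonneg q.imI, sq_nonneg q.imJ, sq_nonneg q.imK]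
  have h3 : x = q.re := sub_eq_zero.mp (pow_eq_zero_iff two_ne_zero |>.mp h2)
  exact hre (h3 ▸ hx)

theorem exists_isFunctionalCalculus {T : QuaternionicOperator H}
    (hT : IsSelfAdjoint (toComplex T)) : ∃ Φ, IsFunctionalCalculus T Φ := by
  let e : C(spectrum ℝ (toComplex T), sphericalSpectrum T) :=
    ⟨fun x => ⟨((x : ℝ) : ℍ), coe_mem_sphericalSpectrum x.2⟩,
      (Quaternion.continuous_coe.comp continuous_subtype_val).subtype_mk _⟩
  let Ψ : C(sphericalSpectrum T, ℝ) →⋆ₐ[ℝ] (ComplexSpace H →L[ℂ] ComplexSpace H) :=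
    (cfcHom hT).comp (ContinuousMap.compStarAlgHom' ℝ ℝ e)
  -- The values lie in the closed star algebra generated by `toComplex T`, hence in the closed range
  -- of `toComplex`.
  have hmem : ∀ f, Ψ f ∈ (toComplex (H := H)).range := fun f =>
    StarAlgebra.elemental.le_of_mem isClosed_range_toComplex ⟨T, rfl⟩ (cfcHom_mem_elemental hT _)
  let Φ : C(sphericalSpectrum T, ℝ) →⋆ₐ[ℝ] QuaternionicOperator H :=
    (StarAlgHomClass.toStarAlgHom
      (StarAlgEquiv.ofInjective (toComplex (H := H)) toComplex_injective).symm).comp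
      (Ψ.codRestrict _ hmem)
  have hΦ : ∀ f, toComplex (Φ f) = Ψ f := fun f =>
    congrArg Subtype.val ((StarAlgEquiv.ofInjective (toComplex (H := H))
      toComplex_injective).apply_symm_apply (Ψ.codRestrict _ hmem f))
  refine ⟨Φ, ?_, ?_, ?_⟩
  · rw [← continuous_toComplex_comp_iff]
    simp only [hΦ]
    exact (cfcHom_continuous hT).comp e.continuous_precomp
  · refine toComplex_injective ?_
    rw [hΦ]
    exact cfcHom_id hT
  · intro f hf
    rw [isPositive_iff_toComplex_nonneg, hΦ]
    exact (cfcHom_nonneg_iff hT).mpr fun x => hf (e x)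

theorem toComplex_funCalc {T : QuaternionicOperator H} (hT : IsSelfAdjoint (toComplex T))
    {f : ℝ → ℝ} (hf : Continuous f) : toComplex (funCalc f T) = cfc f (toComplex T) := by
  have hc : Continuous (fun q : sphericalSpectrum T => f (q : ℍ).re) :=
    hf.comp (Quaternion.continuous_re.comp continuous_subtype_val)
  have h : (∃ Φ, IsFunctionalCalculus T Φ) ∧ Continuous
    (fun q : sphericalSpectrum T => f (q : ℍ).re) := ⟨exists_isFunctionalCalculus hT, hc⟩
  rw [funCalc, dif_pos h]
  have hΦ := h.1.choose_spec
  set Φ := h.1.choose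
  let r : C(sphericalSpectrum T, spectrum ℝ (toComplex T)) :=
    ⟨fun q => ⟨(q : ℍ).re, re_mem_spectrum hT q.2⟩,
      (Quaternion.continuous_re.comp continuous_subtype_val).subtype_mk _⟩
  let Ψ : C(spectrum ℝ (toComplex T), ℝ) →⋆ₐ[ℝ] (ComplexSpace H →L[ℂ] ComplexSpace H) :=
    (toComplex.comp Φ).comp (ContinuousMap.compStarAlgHom' ℝ ℝ r)
  -- Uniqueness of the complex calculus makes the result independent of the chosen `Φ`.
  have hΨ : cfcHom hT = Ψ := by
    refine cfcHom_eq_of_continuous_of_map_id hT Ψ ?_ (congrArg toComplex hΦ.map_id)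
    exact (continuous_toComplex_comp_iff.mpr hΦ.continuous).comp r.continuous_precomp
  rw [cfc_apply f _ hT hf.continuousOn, hΨ]
  rfl

theorem toComplex_rpow {T : QuaternionicOperator H} (hT : 0 ≤ toComplex T) {p : ℝ} (hp : 0 ≤ p) :
    toComplex (rpow T p) = toComplex T ^ p := by
  rw [rpow, toComplex_funCalc hT.isSelfAdjoint (Real.continuous_rpow_const hp),
    CFC.rpow_eq_cfc_real hT]

theorem toComplex_modulus (T : QuaternionicOperator H) :
    toComplex (modulus T) = (star (toComplex T) * toComplex T) ^ (1 / 2 : ℝ) := by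
  rw [modulus, toComplex_rpow, map_mul, map_star]
  · rw [map_mul, map_star]; exact star_mul_self_nonneg _
  · norm_num

theorem isPHyponormal_iff {p : ℝ} (hp : 0 < p) (hp1 : p ≤ 1) {T : QuaternionicOperator H} :
    IsPHyponormal p T ↔ (toComplex T * star (toComplex T)) ^ p ≤
      (star (toComplex T) * toComplex T) ^ p := by
  rw [IsPHyponormal, opLE_iff_toComplex_le, toComplex_rpow _ hp.le, toComplex_rpow _ hp.le]
  · simp only [map_mul, map_star, hp, hp1, true_and]
  · rw [map_mul, map_star]; exact star_mul_self_nonneg _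
  · rw [map_mul, map_star]; exact mul_star_self_nonneg _

/-- The initial projection of the partial isometry `U` fixes the range of `|T|`. -/
theorem IsPolarDecomposition.star_mul_self_mul_modulus {T U : QuaternionicOperator H}
    (hU : IsPolarDecomposition T U) : star U * U * modulus T = modulus T := by
  have hn : 0 ≤ toComplex (modulus T) := toComplex_modulus T ▸ CFC.rpow_nonneg
  have hs : star (modulus T) = modulus T :=
    toComplex_injective (by rw [map_star]; exact hn.isSelfAdjoint)
  have hsq : modulus T * modulus T = star T * T := by
    refine toComplex_injective ?_
    rw [map_mul, toComplex_modulus, ← CFC.rpow_add_of_exponent_nonneg (star_mul_self_nonneg _)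
      (by norm_num) (by norm_num), map_mul, map_star, add_halves,
      CFC.rpow_one _ (star_mul_self_nonneg _)]
  set a := modulus T with ha
  -- Both a² and a U*U a equal T*T, so U*Ua - a maps into ker a, which lies in ker U. Its values are
  -- also orthogonal to themselves, since both U*Ua and a have range orthogonal to ker a.
  have h0 : a * (star U * U * a - a) = 0 := by
    have : star T * T = a * (star U * U * a) := by
      conv_lhs => rw [hU.eq_mul, star_mul, ← ha, hs]
      simp only [mul_assoc]
    rw [mul_sub, ← this, hsq, sub_self]
  refine sub_eq_zero.mp ?_
  ext w
  set v := (star U * U * a - a) w with hv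
  have hav : a v = 0 := DFunLike.congr_fun h0 w
  have hUv : U v = 0 := hU.ker_le v hav
  have e1 : inner ℍ v (adjoint U (U (a w))) = 0 := by
    rw [inner_adjoint_right, hUv, ← zero_smul ℍᵐᵒᵖ v, ← MulOpposite.op_zero, qinner_smul_left,
      star_zero, zero_mul]
  have e2 : inner ℍ v (a w) = 0 := by
    rw [← hs, star_eq_adjoint, inner_adjoint_right, hav, ← zero_smul ℍᵐᵒᵖ v, ← MulOpposite.op_zero,
      qinner_smul_left, star_zero, zero_mul]
  have e3 : adjoint U (U (a w)) = v + a w := (sub_add_cancel _ _).symm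
  rw [e3, qinner_add_right, e2, add_zero] at e1
  have h1 : inner ℝ v v = (0 : ℝ) := by rw [real_inner_def, e1, Quaternion.re_zero]
  exact inner_self_eq_zero.mp h1

end QuaternionicOperator

end

/-! ### Transfer of the theorem to quaternionic operators. -/

open QuaternionicOperator in
theorem mainTheorem2 {H : Type*} [NormedAddCommGroup H] [Module ℍᵐᵒᵖ H]
    [RightQuaternionicInnerProductSpace H] [CompleteSpace H]
    (p : ℝ) (hp0 : 0 < p) (hp : p < 1 / 2) (T U : QuaternionicOperator H)
    (hT : QuaternionicOperator.IsPHyponormal p T)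
    (hU : QuaternionicOperator.IsPolarDecomposition T U) :
    QuaternionicOperator.IsPHyponormal (p + 1 / 2) (QuaternionicOperator.aluthge T U) := by
  have hn : 0 ≤ toComplex (modulus T) := toComplex_modulus T ▸ CFC.rpow_nonneg
  rw [isPHyponormal_iff (by linarith) (by linarith)] at hT ⊢
  have hua := congrArg toComplex hU.star_mul_self_mul_modulus
  rw [map_mul, map_mul, map_star] at hua
  have ht := congrArg toComplex hU.eq_mul
  rw [map_mul] at ht
  have key := rpow_aluthge_le hp0 hp (toComplex_modulus T) ht hua hT
  rwa [aluthge, map_mul, map_mul, toComplex_rpow hn (by norm_num)]
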